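/- For a group $G$, let $cent(G)=\{C_G(g) : g\in G\}$ be the set of centralizers of elements of $G$, and let $nacent(G)$ be the set of non-abelian subgroups belonging to $cent(G)$. A group $G$ is called an AC-group if $C_G(g)$ is abelian for every non-central element $g\in G$. Lemma. Let $q>5$ be a prime power and let $G=PSL(2,q)$. Then: (I) If $q\equiv 0 \pmod 4$, then $G$ is an AC-group and $|nacent(G)|=1$. (II) If $q\equiv 1 \pmod 4$, then $|nacent(G)|=(q^2+q+2)/2$. (III) If $q\equiv 3 \pmod 4$, then $|nacent(G)|=(q^2-q+2)/2$. -/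

import Mathlib

/-- `cent G`: the set of all centralizers `C_G(g)` of elements `g` of `G`. -/
def cent (G : Type*) [Group G] : Set (Subgroup G) :=
  Set.range fun g : G => Subgroup.centralizer {g}

/-- `nacent G`: the set of all nonabelian centralizers belonging to `cent G`. -/
def nacent (G : Type*) [Group G] : Set (Subgroup G) :=
  {H | H ∈ cent G ∧ ¬ ∀ x ∈ H, ∀ y ∈ H, x * y = y * x}

/-- An AC-group: the centralizer of every non-central element is abelian. -/
def IsACGroup (G : Type*) [Group G] : Prop :=
  ∀ g : G, g ∉ Subgroup.center G →
    ∀ x ∈ Subgroup.centralizer {g}, ∀ y ∈ Subgroup.centralizer {g}, x * y = y * x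

/-!
Write `G = PSL(2, F)`. Elements of `SL(2, F)` have the same image in `G` iff they agree up to sign
(`mk_eq_mk_iff`), so the images of `A` and `B` commute iff `AB = ±BA` (`mk_mem_centralizer_iff`).
Two facts about `2 × 2` matrices control centralizers in `G`:

* the matrices commuting with a non-scalar matrix commute with one another
  (`Matrix.mul_comm_of_commute_nonscalar`);
* if `2 ≠ 0` and `BA = -AB`, then `tr A = 0` (`trace_eq_zero_of_anticommute`).

Hence the centralizer of a nontrivial element of `G` is abelian unless `2 ≠ 0` and the element lifts
to a matrix of trace zero (`centralizer_mk_comm`). In characteristic two this already shows that `G`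
is an AC-group whose only nonabelian centralizer is `G` itself.

In odd characteristic let `A` have trace zero. Some `B` anticommutes with `A`
(`exists_anticommute`), because `-1` is a sum of two squares in `F`. As `|F| > 5`, the circle
`a² + b² = 1` has a point off the axes, and the corresponding `C = a + bA` centralizes `A` without
commuting, even up to sign, with any matrix anticommuting with `A` (`exists_commute_not_commute`).
So the centralizer of the image of `A` is nonabelian, and it determines `±A`
(`centralizer_mk_eq_iff`). Therefore `nacent G` consists of `G` and of one subgroup for each pair
`±A` of trace zero (`ncard_nacent`). The matrices of trace zero and determinant one are the
`!![a, b; c, -a]` with `a² + bc = -1`; there are `q (q - 1) + r q` of them, where `r` is the number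
of square roots of `-1` (`ncard_traceless`), which is `2` or `0` according as `q` is `1` or `3`
modulo `4`.
-/

section

open Matrix

open scoped MatrixGroups

/-! ### Two-by-two matrices and commutation up to sign -/

variable {F : Type*} [Field F]

/-- The matrices commuting with a fixed non-scalar `2 × 2` matrix commute with one another:
commuting with `A` makes the vector `(X 0 1, X 1 0, X 0 0 - X 1 1)` proportional to that of `A`. -/
lemma Matrix.mul_comm_of_commute_nonscalar {A X Y : Matrix (Fin 2) (Fin 2) F}
    (hA : ¬ (A 0 1 = 0 ∧ A 1 0 = 0 ∧ A 0 0 = A 1 1))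
    (hX : X * A = A * X) (hY : Y * A = A * Y) : X * Y = Y * X := by
  simp only [← Matrix.ext_iff, Fin.forall_fin_two, mul_apply, Fin.sum_univ_two] at hX hY ⊢
  obtain ⟨⟨x1, x2⟩, x3, -⟩ := hX
  obtain ⟨⟨y1, y2⟩, y3, -⟩ := hY
  have key : X 0 1 * Y 1 0 = Y 0 1 * X 1 0 ∧
      X 0 1 * (Y 0 0 - Y 1 1) = Y 0 1 * (X 0 0 - X 1 1) ∧
      X 1 0 * (Y 0 0 - Y 1 1) = Y 1 0 * (X 0 0 - X 1 1) := by
    by_cases h1 : A 0 1 = 0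
    · by_cases h2 : A 1 0 = 0
      · have h3 : A 0 0 - A 1 1 ≠ 0 := fun h => hA ⟨h1, h2, sub_eq_zero.1 h⟩
        refine ⟨?_, ?_, ?_⟩ <;> refine mul_left_cancel₀ h3 ?_ <;> grind
      · refine ⟨?_, ?_, ?_⟩ <;> refine mul_left_cancel₀ h2 ?_ <;> grind
    · refine ⟨?_, ?_, ?_⟩ <;> refine mul_left_cancel₀ h1 ?_ <;> grind
  obtain ⟨k1, k2, k3⟩ := key
  refine ⟨⟨?_, ?_⟩, ?_, ?_⟩ <;> grind

namespace Matrix.SpecialLinearGroup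

lemma eq_one_or_eq_neg_one_of_scalar {A : SL(2, F)}
    (hA : A 0 1 = 0 ∧ A 1 0 = 0 ∧ A 0 0 = A 1 1) : A = 1 ∨ A = -1 := by
  obtain ⟨h01, h10, h00⟩ := hA
  have hdet := A.2
  rw [det_fin_two, h01, h00, zero_mul, sub_zero, mul_self_eq_one_iff] at hdet
  refine hdet.imp (fun h => ?_) fun h => ?_ <;> ext i j <;> fin_cases i <;> fin_cases j <;>
    simp [h01, h10, h00, h]

lemma mem_center_fin_two_iff {A : SL(2, F)} :
    A ∈ Subgroup.center SL(2, F) ↔ A = 1 ∨ A = -1 := by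
  refine ⟨fun h => eq_one_or_eq_neg_one_of_scalar ?_, ?_⟩
  · obtain ⟨r, -, h⟩ := mem_center_iff.1 h
    simp [← h]
  · rintro (rfl | rfl) <;> rw [Subgroup.mem_center_iff] <;> simp

lemma mk_eq_mk_iff {A B : SL(2, F)} : (A : PSL(2, F)) = B ↔ A = B ∨ A = -B := by
  rw [QuotientGroup.eq, mem_center_fin_two_iff, inv_mul_eq_one, inv_mul_eq_iff_eq_mul]
  refine or_congr_right ⟨fun h => ?_, fun h => ?_⟩ <;> simp [h]

lemma mk_eq_one_iff {A : SL(2, F)} : (A : PSL(2, F)) = 1 ↔ A = 1 ∨ A = -1 :=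
  mk_eq_mk_iff (B := 1)

lemma mk_mem_centralizer_iff {A B : SL(2, F)} :
    (B : PSL(2, F)) ∈ Subgroup.centralizer {(A : PSL(2, F))} ↔ B * A = A * B ∨ B * A = -(A * B) := by
  rw [Subgroup.mem_centralizer_singleton_iff, ← QuotientGroup.mk_mul, ← QuotientGroup.mk_mul,
    mk_eq_mk_iff]

/-- If `BA = -AB` then `B` conjugates `A` to `-A`, so `tr A = -tr A`. -/
lemma trace_eq_zero_of_anticommute (h2 : (2 : F) ≠ 0) {A B : SL(2, F)}
    (h : B * A = -(A * B)) : A 0 0 + A 1 1 = 0 := by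
  have h1 : B * A * B⁻¹ = -A := by rw [h]; simp
  have h3 := congrArg (fun X : SL(2, F) => trace (X : Matrix (Fin 2) (Fin 2) F)) h1
  simp only [coe_mul, coe_neg, trace_neg] at h3
  rw [trace_mul_comm, ← coe_mul, ← coe_mul, inv_mul_cancel_left, trace_fin_two] at h3
  refine (mul_eq_zero.1 ?_).resolve_left h2
  linear_combination h3

lemma mul_comm_of_commute_nonscalar {A X Y : SL(2, F)} (hA : ¬ (A = 1 ∨ A = -1))
    (hX : X * A = A * X) (hY : Y * A = A * Y) : X * Y = Y * X :=
  Subtype.ext <| Matrix.mul_comm_of_commute_nonscalar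
    (fun h => hA (eq_one_or_eq_neg_one_of_scalar h)) (congrArg Subtype.val hX)
    (congrArg Subtype.val hY)

lemma centralizer_mk_comm {A : SL(2, F)} (hA : (A : PSL(2, F)) ≠ 1)
    (h : (2 : F) = 0 ∨ A 0 0 + A 1 1 ≠ 0) :
    ∀ x ∈ Subgroup.centralizer {(A : PSL(2, F))}, ∀ y ∈ Subgroup.centralizer {(A : PSL(2, F))},
      x * y = y * x := by
  have key : ∀ B : SL(2, F), (B : PSL(2, F)) ∈ Subgroup.centralizer {(A : PSL(2, F))} →
      B * A = A * B := by
    intro B hB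
    refine (mk_mem_centralizer_iff.1 hB).elim id fun hB => ?_
    by_cases h2 : (2 : F) = 0
    · have hneg : (-1 : F) = 1 := by linear_combination -h2
      rw [hB]
      ext i j
      rw [coe_neg, neg_apply, ← neg_one_mul, hneg, one_mul]
    · exact absurd (trace_eq_zero_of_anticommute h2 hB) (h.resolve_left h2)
  intro x hx y hy
  induction x using QuotientGroup.induction_on with | _ X
  induction y using QuotientGroup.induction_on with | _ Y
  rw [← QuotientGroup.mk_mul, ← QuotientGroup.mk_mul,
    mul_comm_of_commute_nonscalar (mt mk_eq_one_iff.2 hA) (key X hx) (key Y hy)]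

/-! ### Unitriangular elements and elements of trace zero -/

variable (F) in
/-- The upper unitriangular matrix with off-diagonal entry `1`. -/
def upperUnip : SL(2, F) := ⟨!![1, 1; 0, 1], by simp⟩

variable (F) in
/-- The lower unitriangular matrix with off-diagonal entry `1`. -/
def lowerUnip : SL(2, F) := ⟨!![1, 0; 1, 1], by simp⟩

lemma coe_upperUnip : (upperUnip F : Matrix (Fin 2) (Fin 2) F) = !![1, 1; 0, 1] := rfl

lemma coe_lowerUnip : (lowerUnip F : Matrix (Fin 2) (Fin 2) F) = !![1, 0; 1, 1] := rfl

lemma upperUnip_mul_lowerUnip_ne : ¬ (upperUnip F * lowerUnip F = lowerUnip F * upperUnip F ∨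
    upperUnip F * lowerUnip F = -(lowerUnip F * upperUnip F)) := by
  simp only [SpecialLinearGroup.ext_iff, Fin.forall_fin_two, coe_mul, coe_neg, coe_upperUnip,
    coe_lowerUnip, mul_apply, Fin.sum_univ_two, neg_apply]
  simp
  intro h1 h2
  exact (one_ne_zero (α := F) (by linear_combination h1 - h2)).elim

/-- The traceless elements of `SL(2, F)`; in odd characteristic they are the lifts of the
involutions of `PSL(2, F)`. -/
def traceless (F : Type*) [Field F] : Set SL(2, F) := {A | A 0 0 + A 1 1 = 0}

lemma not_scalar_of_mem_traceless (h2 : (2 : F) ≠ 0) {A : SL(2, F)} (hA : A ∈ traceless F) :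
    ¬ (A = 1 ∨ A = -1) := by
  have hA : A 0 0 + A 1 1 = 0 := hA
  rintro (rfl | rfl)
  · exact h2 (by simpa [one_add_one_eq_two] using hA)
  · refine h2 ?_
    simp at hA
    linear_combination -hA

lemma centralizer_mk_ne_top (h2 : (2 : F) ≠ 0) {A : SL(2, F)} (hA : A ∈ traceless F) :
    Subgroup.centralizer {(A : PSL(2, F))} ≠ ⊤ := by
  intro h
  have key : ∀ B : SL(2, F), B 0 0 + B 1 1 = 2 → B * A = A * B := by
    intro B hB
    refine (mk_mem_centralizer_iff.1 (h ▸ Subgroup.mem_top (B : PSL(2, F)))).elim id fun h' => ?_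
    refine absurd (trace_eq_zero_of_anticommute (A := B) (B := A) h2 ?_) (hB ▸ h2)
    rw [h', neg_neg]
  exact upperUnip_mul_lowerUnip_ne <| .inl <| mul_comm_of_commute_nonscalar
    (not_scalar_of_mem_traceless h2 hA) (key _ (by simp [coe_upperUnip, one_add_one_eq_two]))
    (key _ (by simp [coe_lowerUnip, one_add_one_eq_two]))

/-! ### Tori and the elements inverting them -/

/-- The point `((1 - t²) / (1 + t²), 2t / (1 + t²))` of the unit circle avoids the axes unless `t`
is one of at most five excluded values. -/
lemma exists_sq_add_sq_eq_one [Finite F] (hF : 5 < Nat.card F) (h2 : (2 : F) ≠ 0) :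
    ∃ a b : F, a ^ 2 + b ^ 2 = 1 ∧ a ≠ 0 ∧ b ≠ 0 := by
  classical
  have := Fintype.ofFinite F
  -- The excluded values are the roots of `X ^ 5 - X`, fewer than `|F|`.
  obtain ⟨t, ht⟩ : ∃ t : F, t * (t ^ 2 - 1) * (t ^ 2 + 1) ≠ 0 := by
    by_contra! h
    have hp : (Polynomial.X * (Polynomial.X ^ 2 - 1) * (Polynomial.X ^ 2 + 1) : Polynomial F) =
        Polynomial.X ^ 5 - Polynomial.X := by ring
    have hdeg : (Polynomial.X ^ 5 - Polynomial.X : Polynomial F).natDegree = 5 := by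
      compute_degree!
    have h0 : (Polynomial.X ^ 5 - Polynomial.X : Polynomial F) = 0 := by
      refine Polynomial.eq_zero_of_natDegree_lt_card_of_eval_eq_zero' _ Finset.univ
        (fun x _ => ?_) ?_
      · rw [← hp]; simpa using h x
      · rw [hdeg, Finset.card_univ, ← Nat.card_eq_fintype_card]; exact hF
    simp [h0] at hdeg
  have h1 : t ≠ 0 := by rintro rfl; simp at ht
  have h3 : 1 - t ^ 2 ≠ 0 := fun h => ht (by linear_combination -(t * (t ^ 2 + 1)) * h)
  have h4 : 1 + t ^ 2 ≠ 0 := fun h => ht (by linear_combination (t * (t ^ 2 - 1)) * h)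
  refine ⟨(1 - t ^ 2) / (1 + t ^ 2), 2 * t / (1 + t ^ 2), ?_, div_ne_zero h3 h4,
    div_ne_zero (mul_ne_zero h2 h1) h4⟩
  field_simp
  ring

lemma exists_sq_add_sq_eq_neg_one [Finite F] : ∃ u v : F, u ^ 2 + v ^ 2 = -1 := by
  obtain ⟨p, hp⟩ := CharP.exists F
  have : NeZero p := ⟨CharP.char_ne_zero_of_finite F p⟩
  obtain ⟨a, b, h⟩ := CharP.sq_add_sq F p (-1)
  exact ⟨a, b, by simpa using h⟩

/-- Traceless matrices `A`, `B` anticommute iff `tr (AB) = 0`; requiring `det B = 1` as well leaves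
a conic for `B`, equivalent to `u² + v² = -1`. -/
lemma exists_anticommute [Finite F] {A : SL(2, F)} (hA : A ∈ traceless F) :
    ∃ B ∈ traceless F, B * A = -(A * B) := by
  obtain ⟨u, v, huv⟩ := exists_sq_add_sq_eq_neg_one (F := F)
  have hA : A 0 0 + A 1 1 = 0 := hA
  have hdet := A.2
  rw [det_fin_two] at hdet
  suffices h : ∃ x y z : F, x ^ 2 + y * z = -1 ∧ 2 * A 0 0 * x + A 0 1 * z + A 1 0 * y = 0 by
    obtain ⟨x, y, z, h1, h3⟩ := h
    obtain ⟨B, hB⟩ : ∃ B : SL(2, F), (B : Matrix (Fin 2) (Fin 2) F) = !![x, y; z, -x] :=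
      ⟨⟨!![x, y; z, -x], by rw [det_fin_two_of]; linear_combination -h1⟩, rfl⟩
    refine ⟨B, by simp [traceless, hB], ?_⟩
    simp only [SpecialLinearGroup.ext_iff, Fin.forall_fin_two, coe_mul, coe_neg, hB,
      mul_apply, Fin.sum_univ_two, neg_apply]
    simp
    refine ⟨⟨?_, ?_⟩, ?_, ?_⟩ <;> grind
  by_cases h01 : A 0 1 = 0
  · by_cases h10 : A 1 0 = 0
    · exact ⟨0, 1, -1, by ring, by simp [h01, h10]⟩
    · -- Symmetric to the last case, with the off-diagonal entries interchanged.
      refine ⟨u + A 0 0 * v, -(2 * A 0 0 * (u + A 0 0 * v) + A 0 1 * (A 1 0 * v)) / A 1 0, A 1 0 * v,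
        ?_, ?_⟩
      · field_simp; grind
      · field_simp; ring
  · -- With `z` eliminated, `x² + yz = -1` reads `(A₀₁x - A₀₀y)² + y² = -A₀₁²`, because
    -- `A₀₀² + A₀₁A₁₀ = -1`; so take `y = A₀₁v` and `A₀₁x - A₀₀y = A₀₁u`.
    refine ⟨u + A 0 0 * v, A 0 1 * v, -(2 * A 0 0 * (u + A 0 0 * v) + A 1 0 * (A 0 1 * v)) / A 0 1,
      ?_, ?_⟩
    · field_simp; grind
    · field_simp; ring

/-- An element `a + bA` of the torus `F[A]` with `ab ≠ 0` has no image commuting with that of any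
`B` anticommuting with `A`, since `B (a + bA) = (a - bA) B`. -/
lemma exists_commute_not_commute [Finite F] (hF : 5 < Nat.card F) (h2 : (2 : F) ≠ 0)
    {A : SL(2, F)} (hA : A ∈ traceless F) :
    ∃ C : SL(2, F), C * A = A * C ∧
      ∀ B : SL(2, F), B * A = -(A * B) → ¬ (C * B = B * C ∨ C * B = -(B * C)) := by
  obtain ⟨a, b, hab, ha, hb⟩ := exists_sq_add_sq_eq_one hF h2
  have htr : A 0 0 + A 1 1 = 0 := hA
  have hdet := A.2
  rw [det_fin_two] at hdet
  let C : SL(2, F) := ⟨a • (1 : Matrix (Fin 2) (Fin 2) F) + b • (A : Matrix (Fin 2) (Fin 2) F), by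
    simp [det_fin_two]; grind⟩
  have hC : (C : Matrix (Fin 2) (Fin 2) F) = a • 1 + b • (A : Matrix (Fin 2) (Fin 2) F) := rfl
  refine ⟨C, Subtype.ext <| by simp [hC, add_mul, mul_add], fun B hB h => ?_⟩
  have hBA : (B * A : Matrix (Fin 2) (Fin 2) F) = -(A * B) := congrArg Subtype.val hB
  have hAB : ((A * B : SL(2, F)) : Matrix (Fin 2) (Fin 2) F) ≠ 0 := by
    intro h0
    have := (A * B).2
    rw [h0] at this
    simp at this
  have hB0 : (B : Matrix (Fin 2) (Fin 2) F) ≠ 0 := by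
    intro h0
    have := B.2
    rw [h0] at this
    simp at this
  rcases h with h | h
  · have h' : (C * B : Matrix (Fin 2) (Fin 2) F) = B * C := congrArg Subtype.val h
    rw [hC, add_mul, mul_add, Matrix.smul_mul, Matrix.smul_mul, Matrix.mul_smul,
      Matrix.mul_smul, one_mul, mul_one, hBA] at h'
    have : (2 * b) • (A * B : Matrix (Fin 2) (Fin 2) F) = 0 := by
      rw [← sub_eq_zero.2 h']
      module
    exact (smul_eq_zero.1 this).elim (mul_ne_zero h2 hb) hAB
  · have h' : (C * B : Matrix (Fin 2) (Fin 2) F) = -(B * C) := congrArg Subtype.val h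
    rw [hC, add_mul, mul_add, Matrix.smul_mul, Matrix.smul_mul, Matrix.mul_smul,
      Matrix.mul_smul, one_mul, mul_one, hBA] at h'
    have : (2 * a) • (B : Matrix (Fin 2) (Fin 2) F) = 0 := by
      rw [← sub_eq_zero.2 h']
      module
    exact (smul_eq_zero.1 this).elim (mul_ne_zero h2 ha) hB0

/-! ### Nonabelian centralizers -/

lemma centralizer_mk_not_comm [Finite F] (hF : 5 < Nat.card F) (h2 : (2 : F) ≠ 0) {A : SL(2, F)}
    (hA : A ∈ traceless F) :
    ¬ ∀ x ∈ Subgroup.centralizer {(A : PSL(2, F))},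
      ∀ y ∈ Subgroup.centralizer {(A : PSL(2, F))}, x * y = y * x := by
  intro h
  obtain ⟨C, hC, hCB⟩ := exists_commute_not_commute hF h2 hA
  obtain ⟨B, -, hB⟩ := exists_anticommute hA
  exact hCB B hB <| mk_mem_centralizer_iff.1 <| Subgroup.mem_centralizer_singleton_iff.2 <|
    h _ (mk_mem_centralizer_iff.2 (.inl hC)) _ (mk_mem_centralizer_iff.2 (.inr hB))

lemma inv_eq_neg_of_mem_traceless {A : SL(2, F)} (hA : A ∈ traceless F) : A⁻¹ = -A := by
  have hA : A 0 0 + A 1 1 = 0 := hA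
  simp only [SpecialLinearGroup.ext_iff, Fin.forall_fin_two, coe_inv, coe_neg, adjugate_fin_two,
    neg_apply]
  simp
  exact ⟨by linear_combination hA, by linear_combination hA⟩

lemma eq_one_or_eq_neg_one_of_inv_eq_self (h2 : (2 : F) ≠ 0) {A : SL(2, F)} (hA : A⁻¹ = A) :
    A = 1 ∨ A = -1 := by
  simp only [SpecialLinearGroup.ext_iff, Fin.forall_fin_two, coe_inv, adjugate_fin_two] at hA
  obtain ⟨⟨h00, h01⟩, h10, -⟩ := hA
  simp at h00 h01 h10
  refine eq_one_or_eq_neg_one_of_scalar ⟨?_, ?_, h00.symm⟩ <;>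
    refine (mul_eq_zero.1 ?_).resolve_left h2
  · linear_combination -h01
  · linear_combination -h10

/-- Distinct involutions of `PSL(2, F)` have distinct centralizers: an involution `B` centralizing
`A` but different from it lifts to an element anticommuting with `A`, which does not centralize
the torus through `A`. -/
lemma centralizer_mk_eq_iff [Finite F] (hF : 5 < Nat.card F) (h2 : (2 : F) ≠ 0) {A B : SL(2, F)}
    (hA : A ∈ traceless F) (hB : B ∈ traceless F) :
    Subgroup.centralizer {(A : PSL(2, F))} = Subgroup.centralizer {(B : PSL(2, F))} ↔
      A = B ∨ A = -B := by
  refine ⟨fun h => ?_, fun h => by rw [mk_eq_mk_iff.2 h]⟩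
  obtain ⟨C, hC, hCB⟩ := exists_commute_not_commute hF h2 hA
  have hBA : (B : PSL(2, F)) ∈ Subgroup.centralizer {(A : PSL(2, F))} := by
    rw [h]; exact mk_mem_centralizer_iff.2 (.inl rfl)
  have hCB' : (C : PSL(2, F)) ∈ Subgroup.centralizer {(B : PSL(2, F))} := by
    rw [← h]; exact mk_mem_centralizer_iff.2 (.inl hC)
  rcases mk_mem_centralizer_iff.1 hBA with hBA | hBA
  · -- Here `AB` is its own inverse, since `A⁻¹ = -A` and `B⁻¹ = -B`.
    have hinv : (A * B)⁻¹ = A * B := by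
      rw [_root_.mul_inv_rev, inv_eq_neg_of_mem_traceless hA, inv_eq_neg_of_mem_traceless hB, neg_mul_neg,
        hBA]
    rcases eq_one_or_eq_neg_one_of_inv_eq_self h2 hinv with h | h
    · right
      rw [← inv_eq_neg_of_mem_traceless hB]
      exact eq_inv_of_mul_eq_one_left h
    · left
      have h' : -A = B⁻¹ := eq_inv_of_mul_eq_one_left (by rw [neg_mul, h, neg_neg])
      rwa [inv_eq_neg_of_mem_traceless hB, neg_inj] at h'
  · exact absurd (mk_mem_centralizer_iff.1 hCB') (hCB B hBA)

lemma not_comm_top : ¬ ∀ x ∈ (⊤ : Subgroup PSL(2, F)), ∀ y ∈ (⊤ : Subgroup PSL(2, F)),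
    x * y = y * x := fun h =>
  upperUnip_mul_lowerUnip_ne <| mk_mem_centralizer_iff.1 <|
    Subgroup.mem_centralizer_singleton_iff.2 <|
    h (upperUnip F : PSL(2, F)) trivial (lowerUnip F : PSL(2, F)) trivial

lemma top_mem_nacent : (⊤ : Subgroup PSL(2, F)) ∈ nacent PSL(2, F) :=
  ⟨⟨1, by simp [Subgroup.eq_top_iff', Subgroup.mem_centralizer_singleton_iff]⟩, not_comm_top⟩

lemma nacent_eq_of_two_eq_zero (h2 : (2 : F) = 0) : nacent PSL(2, F) = {⊤} := by
  refine Set.eq_singleton_iff_unique_mem.2 ⟨top_mem_nacent, ?_⟩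
  rintro _ ⟨⟨g, rfl⟩, hg⟩
  induction g using QuotientGroup.induction_on with | _ A
  by_cases hA : (A : PSL(2, F)) = 1
  · simp [hA, Subgroup.eq_top_iff', Subgroup.mem_centralizer_singleton_iff]
  · exact absurd (centralizer_mk_comm hA (.inl h2)) hg

lemma isACGroup_of_two_eq_zero (h2 : (2 : F) = 0) : IsACGroup PSL(2, F) := by
  intro g hg
  induction g using QuotientGroup.induction_on with | _ A
  exact centralizer_mk_comm (fun h => hg (h ▸ one_mem _)) (.inl h2)

lemma nacent_eq_insert [Finite F] (hF : 5 < Nat.card F) (h2 : (2 : F) ≠ 0) :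
    nacent PSL(2, F) =
      insert ⊤ ((fun A : SL(2, F) => Subgroup.centralizer {(A : PSL(2, F))}) '' traceless F) := by
  refine Set.Subset.antisymm ?_ (Set.insert_subset top_mem_nacent ?_)
  · rintro _ ⟨⟨g, rfl⟩, hg⟩
    induction g using QuotientGroup.induction_on with | _ A
    by_cases hA : (A : PSL(2, F)) = 1
    · left
      simp [hA, Subgroup.eq_top_iff', Subgroup.mem_centralizer_singleton_iff]
    · exact .inr ⟨A, by_contra fun h => hg (centralizer_mk_comm hA (.inr h)), rfl⟩
  · rintro _ ⟨A, hA, rfl⟩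
    exact ⟨⟨A, rfl⟩, centralizer_mk_not_comm hF h2 hA⟩

/-- The map sending a traceless `A` to the centralizer of its image has fibres `{A, -A}`. -/
lemma ncard_nacent [Finite F] (hF : 5 < Nat.card F) (h2 : (2 : F) ≠ 0) :
    2 * (nacent PSL(2, F)).ncard = (traceless F).ncard + 2 := by
  classical
  have hfin : (traceless F).Finite := Set.toFinite _
  rw [nacent_eq_insert hF h2, Set.ncard_insert_of_notMem, mul_add, mul_one]
  · congr 1
    rw [Set.ncard_eq_toFinset_card _ hfin, Finset.card_eq_sum_card_image
        (fun A : SL(2, F) => Subgroup.centralizer {(A : PSL(2, F))}) hfin.toFinset,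
      Finset.sum_const_nat (m := 2), mul_comm]
    · rw [← Set.ncard_coe_finset]
      simp
    · simp only [Finset.mem_image, Set.Finite.mem_toFinset]
      rintro _ ⟨A, hA, rfl⟩
      have hneg : -A ∈ traceless F := by
        have hA : A 0 0 + A 1 1 = 0 := hA
        simp only [traceless, Set.mem_ofPred_eq, coe_neg, neg_apply]
        linear_combination -hA
      have hne : A ≠ -A := by
        intro h
        have h' : ∀ i j, A i j = 0 := by
          intro i j
          have := congrArg (fun X : SL(2, F) => X i j) h
          simp only [coe_neg, neg_apply] at this
          refine (mul_eq_zero.1 ?_).resolve_left h2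
          linear_combination this
        have := A.2
        rw [det_fin_two] at this
        simp [h'] at this
      refine Eq.trans (congrArg Finset.card ?_) (Finset.card_pair hne)
      ext B
      simp only [Finset.mem_filter, Set.Finite.mem_toFinset, Finset.mem_insert,
        Finset.mem_singleton]
      constructor
      · rintro ⟨hB, h⟩
        exact (centralizer_mk_eq_iff hF h2 hB hA).1 h
      · rintro (rfl | rfl)
        · exact ⟨hA, rfl⟩
        · exact ⟨hneg, (centralizer_mk_eq_iff hF h2 hneg hA).2 (.inr rfl)⟩
  · rintro ⟨A, hA, h⟩
    exact centralizer_mk_ne_top h2 hA h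

/-! ### Counting elements of trace zero -/

/-- The traceless element `!![a, b; c, -a]` of `SL(2, F)`. -/
def mkTraceless (a b c : F) (h : a ^ 2 + b * c = -1) : traceless F :=
  ⟨⟨!![a, b; c, -a], by rw [det_fin_two_of]; linear_combination -h⟩, add_neg_cancel a⟩

lemma coe_mkTraceless (a b c : F) (h : a ^ 2 + b * c = -1) :
    ((mkTraceless a b c h : SL(2, F)) : Matrix (Fin 2) (Fin 2) F) = !![a, b; c, -a] := rfl

lemma sq_add_mul_eq_neg_one (A : traceless F) : A.1 0 0 ^ 2 + A.1 0 1 * A.1 1 0 = -1 := by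
  have h1 : A.1 0 0 + A.1 1 1 = 0 := A.2
  have h2 := A.1.2
  rw [det_fin_two] at h2
  linear_combination A.1 0 0 * h1 - h2

lemma traceless_ext {A B : traceless F} (h00 : A.1 0 0 = B.1 0 0) (h01 : A.1 0 1 = B.1 0 1)
    (h10 : A.1 1 0 = B.1 1 0) : A = B := by
  have hA : A.1 0 0 + A.1 1 1 = 0 := A.2
  have hB : B.1 0 0 + B.1 1 1 = 0 := B.2
  refine Subtype.ext (SpecialLinearGroup.ext _ _ ?_)
  simp only [Fin.forall_fin_two]
  exact ⟨⟨h00, h01⟩, h10, by linear_combination hA - hB - h00⟩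

open scoped Classical in
/-- A traceless matrix of determinant one is `!![a, b; c, -a]` with `a² + bc = -1`; either `b ≠ 0`,
and then `c` is determined by `a` and `b`, or `b = 0`, and then `a² = -1` and `c` is arbitrary. -/
noncomputable def tracelessEquiv : traceless F ≃ (Fˣ × F) ⊕ ({a : F // a ^ 2 = -1} × F) where
  toFun A := if h : A.1 0 1 = 0 then
      .inr (⟨A.1 0 0, by simpa [h] using sq_add_mul_eq_neg_one A⟩, A.1 1 0)
    else .inl (Units.mk0 _ h, A.1 0 0)
  invFun := Sum.elim
    (fun p => mkTraceless p.2 p.1 (-(1 + p.2 ^ 2) * (p.1⁻¹ : Fˣ)) (by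
      linear_combination -(1 + p.2 ^ 2) * p.1.mul_inv))
    (fun p => mkTraceless p.1 0 p.2 (by rw [zero_mul, add_zero, p.1.2]))
  left_inv A := by
    have hA := sq_add_mul_eq_neg_one A
    by_cases h : A.1 0 1 = 0
    · beta_reduce
      rw [dif_pos h]
      exact traceless_ext rfl h.symm rfl
    · beta_reduce
      rw [dif_neg h]
      refine traceless_ext rfl rfl ?_
      simp only [Sum.elim_inl, coe_mkTraceless]
      simp
      field_simp
      linear_combination -hA
  right_inv x := by
    rcases x with ⟨b, a⟩ | ⟨a, c⟩
    · simp [coe_mkTraceless]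
    · simp [coe_mkTraceless]

lemma ncard_traceless [Finite F] : (traceless F).ncard =
    (Nat.card F - 1) * Nat.card F + Nat.card {a : F // a ^ 2 = -1} * Nat.card F := by
  have := Fintype.ofFinite F
  rw [← Nat.card_coe_set_eq, Nat.card_congr tracelessEquiv, Nat.card_sum, Nat.card_prod,
    Nat.card_prod, Nat.card_units]

lemma card_sq_eq_neg_one_of_card_mod_four_eq_one [Finite F] (h2 : (2 : F) ≠ 0)
    (hF : Nat.card F % 4 = 1) : Nat.card {a : F // a ^ 2 = -1} = 2 := by
  have := Fintype.ofFinite F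
  rw [Nat.card_eq_fintype_card] at hF
  obtain ⟨i, hi⟩ := (FiniteField.isSquare_neg_one_iff (F := F)).2 (by omega)
  have hset : {a : F | a ^ 2 = -1} = {i, -i} := by
    ext a
    simp only [Set.mem_ofPred_eq, Set.mem_insert_iff, Set.mem_singleton_iff]
    rw [hi, ← sq, sq_eq_sq_iff_eq_or_eq_neg]
  have hne : i ≠ -i := by
    intro h
    have h0 : i = 0 := (mul_eq_zero.1 (by linear_combination h : 2 * i = 0)).resolve_left h2
    simp [h0] at hi
  have := Set.ncard_pair hne
  rwa [← hset, ← Nat.card_coe_set_eq] at this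

lemma card_sq_eq_neg_one_of_card_mod_four_eq_three [Finite F] (hF : Nat.card F % 4 = 3) :
    Nat.card {a : F // a ^ 2 = -1} = 0 := by
  have := Fintype.ofFinite F
  rw [Nat.card_eq_fintype_card] at hF
  have : IsEmpty {a : F // a ^ 2 = -1} := ⟨fun a =>
    (FiniteField.isSquare_neg_one_iff (F := F)).1 ⟨a, by rw [← sq, a.2]⟩ hF⟩
  exact Nat.card_of_isEmpty

lemma two_eq_zero_iff_even_card [Finite F] : (2 : F) = 0 ↔ Even (Nat.card F) := by
  have := Fintype.ofFinite F
  rw [Nat.card_eq_fintype_card, Nat.even_iff, ← FiniteField.even_card_iff_char_two]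
  constructor
  · intro h
    exact CharP.ringChar_of_prime_eq_zero Nat.prime_two (by exact_mod_cast h)
  · intro h
    exact_mod_cast (ringChar.spec F 2).2 h.dvd

end Matrix.SpecialLinearGroup

end

/-! ### The count of nonabelian centralizers -/

open Matrix.SpecialLinearGroup in
theorem mainTheorem2 (q : ℕ) (hq : IsPrimePow q) (hq5 : 5 < q)
    (F : Type*) [Field F] [Finite F] (hF : Nat.card F = q) :
    (q ≡ 0 [MOD 4] →
      IsACGroup (Matrix.ProjectiveSpecialLinearGroup (Fin 2) F) ∧
      (nacent (Matrix.ProjectiveSpecialLinearGroup (Fin 2) F)).ncard = 1) ∧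
    (q ≡ 1 [MOD 4] →
      ((nacent (Matrix.ProjectiveSpecialLinearGroup (Fin 2) F)).ncard : ℚ) =
        ((q : ℚ) ^ 2 + q + 2) / 2) ∧
    (q ≡ 3 [MOD 4] →
      ((nacent (Matrix.ProjectiveSpecialLinearGroup (Fin 2) F)).ncard : ℚ) =
        ((q : ℚ) ^ 2 - q + 2) / 2) := by
  subst hF
  simp only [Nat.ModEq]
  have hodd : Nat.card F % 2 = 1 → (2 : F) ≠ 0 := fun h h2 => by
    have := Nat.even_iff.1 (two_eq_zero_iff_even_card.1 h2)
    omega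
  have hcast : ((Nat.card F - 1 : ℕ) : ℚ) = Nat.card F - 1 := by
    rw [Nat.cast_sub (by omega), Nat.cast_one]
  refine ⟨fun h => ?_, fun h => ?_, fun h => ?_⟩
  · have h2 : (2 : F) = 0 := two_eq_zero_iff_even_card.2 (Nat.even_iff.2 (by omega))
    exact ⟨isACGroup_of_two_eq_zero h2, by rw [nacent_eq_of_two_eq_zero h2, Set.ncard_singleton]⟩
  · have h2 := hodd (by omega)
    have key := congrArg (Nat.cast : ℕ → ℚ) (ncard_nacent hq5 h2)
    rw [ncard_traceless, card_sq_eq_neg_one_of_card_mod_four_eq_one h2 h] at key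
    push_cast [hcast] at key
    linear_combination key / 2
  · have h2 := hodd (by omega)
    have key := congrArg (Nat.cast : ℕ → ℚ) (ncard_nacent hq5 h2)
    rw [ncard_traceless, card_sq_eq_neg_one_of_card_mod_four_eq_three h] at key
    push_cast [hcast] at key
    linear_combination key / 2
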